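/- All graphs are finite, undirected and simple. Let $C_4^+$ be the diamond graph, consisting of a $4$-cycle together with one chord. A graph $G$ is called \emph{uniquely $C_4^+$-saturated} if $G$ contains no subgraph (not necessarily induced) isomorphic to $C_4^+$, but for every pair of distinct non-adjacent vertices $u,v$ of $G$ the graph $G+uv$ obtained by adding the edge $uv$ contains exactly one subgraph isomorphic to $C_4^+$. Theorem. There is no uniquely $C_4^+$-saturated graph with exactly four triangles. -/

import Mathlib

namespace SimpleGraph

/-- The diamond `C₄⁺`: the cycle `0 1 2 3` of length four together with the chord `02`. -/
def diamond : SimpleGraph (Fin 4) := cycleGraph 4 ⊔ edge 0 2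

/-- `G` is `H`-saturated: `G` contains no (not necessarily induced) copy of `H`, but adding any
missing edge to `G` creates one. -/
def IsSaturated {V W : Type*} (G : SimpleGraph V) (H : SimpleGraph W) : Prop :=
  H.Free G ∧ ∀ u v : V, u ≠ v → ¬ G.Adj u v → H ⊑ G ⊔ edge u v

/-- `G` is uniquely `H`-saturated: `G` is `H`-saturated and adding any missing edge to `G` creates
exactly one copy of `H`, where copies are counted as subgraphs. -/
def IsUniquelySaturated {V W : Type*} [Fintype V] (G : SimpleGraph V) (H : SimpleGraph W) : Prop :=
  G.IsSaturated H ∧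
    ∀ u v : V, u ≠ v → ¬ G.Adj u v → (G ⊔ edge u v).copyCount H = 1

/-- The number of triangles of `G`, that is, of three-element sets of pairwise adjacent vertices. -/
noncomputable def triangleCount {V : Type*} (G : SimpleGraph V) : ℕ :=
  (G.cliqueSet 3).ncard

end SimpleGraph

/-! Colour an edge red if it lies in a triangle and blue otherwise. Diamond-freeness puts each edge
in at most one triangle. By uniqueness, a non-adjacent pair is joined by exactly two blue-blue paths
or by exactly one path of length two with one edge of each colour (`common_cases`). Hence triangles
are vertex-disjoint and blue degree is constant along blue edges. Weighting mixed paths by 2 and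
summing over endpoints yields `card_eq`, which expresses the order through local data at any vertex.

With four triangles, `card_eq` rules out that they cover all vertices. A vertex `v` outside them
sends exactly one blue edge to each triangle (`card_blueTriNbr_of_forall_not_redAdj`). Comparing
`card_eq` at `v` and at the three vertices of one triangle leaves finitely many blue degrees, none
consistent. -/

namespace SimpleGraph

/-! ### Edge colours and common neighbours of non-adjacent pairs -/

section Diamond

variable {V : Type*} {G : SimpleGraph V}

/-- The vertices `a b c d` span a diamond with cycle `a b c d` and chord `ac`. -/
structure IsDiamond (G : SimpleGraph V) (a b c d : V) : Prop where
  ab : G.Adj a b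
  bc : G.Adj b c
  cd : G.Adj c d
  da : G.Adj d a
  ac : G.Adj a c
  bd : b ≠ d

lemma diamond_adj {i j : Fin 4} :
    diamond.Adj i j ↔ i ≠ j ∧ ¬ (i = 1 ∧ j = 3) ∧ ¬ (i = 3 ∧ j = 1) := by
  simp only [diamond, sup_adj, edge_adj, cycleGraph_adj]
  revert i j
  decide

lemma IsDiamond.exists_copy {a b c d : V} (h : G.IsDiamond a b c d) :
    ∃ f : Copy diamond G, Set.range f = {a, b, c, d} := by
  have hab := h.ab.ne
  have hbc := h.bc.ne
  have hcd := h.cd.ne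
  have hda := h.da.ne
  have hac := h.ac.ne
  have hbd := h.bd
  refine ⟨⟨⟨![a, b, c, d], ?_⟩, ?_⟩, ?_⟩
  · intro i j hij
    rw [diamond_adj] at hij
    fin_cases i <;> fin_cases j <;>
      simp_all [h.ab, h.bc, h.cd, h.da, h.ac, h.ab.symm, h.bc.symm, h.cd.symm, h.da.symm,
        h.ac.symm]
  · intro i j hij
    fin_cases i <;> fin_cases j <;> simp_all [eq_comm]
  · ext x
    change (∃ i, ![a, b, c, d] i = x) ↔ _
    simp [Fin.exists_fin_succ, eq_comm]

lemma exists_isDiamond_of_isContained (h : diamond ⊑ G) : ∃ a b c d, G.IsDiamond a b c d := by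
  obtain ⟨f⟩ := h
  have key : ∀ i j, diamond.Adj i j → G.Adj (f i) (f j) := fun i j hij ↦ f.toHom.map_adj hij
  refine ⟨f 0, f 1, f 2, f 3, ?_, ?_, ?_, ?_, ?_, fun h ↦ by simpa using f.injective h⟩ <;>
    exact key _ _ (by simp [diamond_adj])

lemma IsDiamond.eq_of_copyCount_eq_one [Fintype V] (hG : G.copyCount diamond = 1)
    {a b c d a' b' c' d' : V} (h : G.IsDiamond a b c d) (h' : G.IsDiamond a' b' c' d') :
    ({a, b, c, d} : Set V) = {a', b', c', d'} := by
  classical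
  obtain ⟨f, hf⟩ := h.exists_copy
  obtain ⟨g, hg⟩ := h'.exists_copy
  have : f.toSubgraph = g.toSubgraph := by
    unfold copyCount at hG
    exact Finset.card_le_one.1 hG.le _ (by simpa using ⟨f.isoToSubgraph⟩) _
      (by simpa using ⟨g.isoToSubgraph⟩)
  have := congrArg Subgraph.verts this
  simpa [hf, hg] using this

/-- An edge that lies in a triangle. -/
def RedAdj (G : SimpleGraph V) (x y : V) : Prop := G.Adj x y ∧ ∃ z, G.Adj x z ∧ G.Adj y z

/-- An edge that lies in no triangle. -/
def BlueAdj (G : SimpleGraph V) (x y : V) : Prop := G.Adj x y ∧ ¬ G.RedAdj x y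

lemma RedAdj.symm {x y : V} (h : G.RedAdj x y) : G.RedAdj y x := by
  obtain ⟨h, z, h1, h2⟩ := h
  exact ⟨h.symm, z, h2, h1⟩

lemma BlueAdj.symm {x y : V} (h : G.BlueAdj x y) : G.BlueAdj y x :=
  ⟨h.1.symm, fun h' ↦ h.2 h'.symm⟩

lemma redAdj_comm {x y : V} : G.RedAdj x y ↔ G.RedAdj y x := ⟨.symm, .symm⟩

lemma blueAdj_comm {x y : V} : G.BlueAdj x y ↔ G.BlueAdj y x := ⟨.symm, .symm⟩

lemma BlueAdj.not_adj_of_adj {x y z : V} (h : G.BlueAdj x y) (hy : G.Adj y z) : ¬ G.Adj x z :=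
  fun hx ↦ h.2 ⟨h.1, z, hx, hy⟩

lemma RedAdj.exists_triangle {x y : V} (h : G.RedAdj x y) :
    ∃ z, y ≠ z ∧ G.RedAdj x z ∧ G.RedAdj y z := by
  obtain ⟨h, z, hx, hy⟩ := h
  exact ⟨z, hy.ne, ⟨hx, y, h, hy.symm⟩, hy, x, h.symm, hx.symm⟩

lemma sup_edge_adj_iff {u v x y : V} (huv : u ≠ v) :
    (G ⊔ edge u v).Adj x y ↔ G.Adj x y ∨ (x = u ∧ y = v) ∨ (x = v ∧ y = u) := by
  simp only [sup_adj, edge_adj]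
  grind

lemma sup_isDiamond_two {u v w z : V} (huv : u ≠ v) (hwz : w ≠ z) (huw : G.Adj u w)
    (hvw : G.Adj v w) (huz : G.Adj u z) (hvz : G.Adj v z) :
    (G ⊔ edge u v).IsDiamond u w v z := by
  refine ⟨?_, ?_, ?_, ?_, ?_, hwz⟩ <;> rw [sup_edge_adj_iff huv]
  · exact .inl huw
  · exact .inl hvw.symm
  · exact .inl hvz
  · exact .inl huz.symm
  · simp

lemma sup_isDiamond_red {u v w x : V} (huv : u ≠ v) (huw : G.Adj u w) (hvw : G.Adj v w)
    (hux : G.Adj u x) (hwx : G.Adj w x) (hvx : v ≠ x) :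
    (G ⊔ edge u v).IsDiamond u v w x := by
  refine ⟨?_, ?_, ?_, ?_, ?_, hvx⟩ <;> rw [sup_edge_adj_iff huv]
  · simp
  · exact .inl hvw
  · exact .inl hwx
  · exact .inl hux.symm
  · exact .inl huw

namespace IsUniquelySaturated

variable [Fintype V]

lemma eq_of_common (hG : G.IsUniquelySaturated diamond) {x y z w : V} (h : G.Adj x y)
    (hxz : G.Adj x z) (hyz : G.Adj y z) (hxw : G.Adj x w) (hyw : G.Adj y w) : z = w := by
  by_contra hne
  obtain ⟨f, -⟩ := IsDiamond.exists_copy (G := G) (a := x) (b := z) (c := y) (d := w)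
    ⟨hxz, hyz.symm, hyw, hxw.symm, h, hne⟩
  exact hG.1.1 ⟨f⟩

/-- A new diamond must use `uv`: as its chord in the first case, as a side in the second, where the
old triangle makes one edge red. -/
lemma exists_common (hG : G.IsUniquelySaturated diamond) {u v : V} (huv : u ≠ v)
    (h : ¬ G.Adj u v) :
    (∃ w z, w ≠ z ∧ G.Adj u w ∧ G.Adj v w ∧ G.Adj u z ∧ G.Adj v z) ∨
      ∃ w, G.Adj u w ∧ G.Adj v w ∧ (G.RedAdj u w ∨ G.RedAdj v w) := by
  obtain ⟨a, b, c, d, hab, hbc, hcd, hda, hac, hbd⟩ :=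
    exists_isDiamond_of_isContained (hG.1.2 u v huv h)
  have key : ¬ (G.Adj a b ∧ G.Adj b c ∧ G.Adj c d ∧ G.Adj d a ∧ G.Adj a c) :=
    fun ⟨h1, h2, h3, h4, h5⟩ ↦ hbd (hG.eq_of_common h5 h1 h2.symm h4.symm h3)
  rw [sup_edge_adj_iff huv] at *
  unfold RedAdj
  have hs : ∀ x y, G.Adj x y → G.Adj y x := fun _ _ h ↦ h.symm
  have hi : ∀ x, ¬ G.Adj x x := fun x ↦ G.loopless.irrefl x
  grind

variable (hG : G.IsUniquelySaturated diamond) {u v w z y : V}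
include hG

lemma eq_or_eq_of_common (huv : u ≠ v) (h : ¬ G.Adj u v) (hwz : w ≠ z) (huw : G.Adj u w)
    (hvw : G.Adj v w) (huz : G.Adj u z) (hvz : G.Adj v z) (huy : G.Adj u y) (hvy : G.Adj v y) :
    y = w ∨ y = z := by
  by_contra! hne
  have := (sup_isDiamond_two huv hwz huw hvw huz hvz).eq_of_copyCount_eq_one (hG.2 u v huv h)
    (sup_isDiamond_two huv hne.1.symm huw hvw huy hvy)
  have hy : y ∈ ({u, w, v, z} : Set V) := by rw [this]; simp
  simp only [Set.mem_insert_iff, Set.mem_singleton_iff] at hy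
  rcases hy with rfl | rfl | rfl | rfl
  · exact huy.ne rfl
  · exact hne.1 rfl
  · exact hvy.ne rfl
  · exact hne.2 rfl

lemma not_redAdj_of_two (huv : u ≠ v) (h : ¬ G.Adj u v) (hwz : w ≠ z) (huw : G.Adj u w)
    (hvw : G.Adj v w) (huz : G.Adj u z) (hvz : G.Adj v z) : ¬ G.RedAdj u w := by
  rintro ⟨-, x, hux, hwx⟩
  have hxv : v ≠ x := by rintro rfl; exact h hux
  have hxz : x ≠ z := by
    rintro rfl
    exact huv (hG.eq_of_common hwx huw.symm huz.symm hvw.symm hvz.symm)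
  have := (sup_isDiamond_two huv hwz huw hvw huz hvz).eq_of_copyCount_eq_one (hG.2 u v huv h)
    (sup_isDiamond_red huv huw hvw hux hwx hxv)
  have hx : x ∈ ({u, w, v, z} : Set V) := by rw [this]; simp
  simp only [Set.mem_insert_iff, Set.mem_singleton_iff] at hx
  rcases hx with rfl | rfl | rfl | rfl
  · exact hux.ne rfl
  · exact hwx.ne rfl
  · exact hxv rfl
  · exact hxz rfl

lemma blueAdj_of_two (huv : u ≠ v) (h : ¬ G.Adj u v) (hwz : w ≠ z) (huw : G.Adj u w)
    (hvw : G.Adj v w) (huz : G.Adj u z) (hvz : G.Adj v z) : G.BlueAdj u w ∧ G.BlueAdj v w :=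
  ⟨⟨huw, hG.not_redAdj_of_two huv h hwz huw hvw huz hvz⟩,
    ⟨hvw, hG.not_redAdj_of_two huv.symm (fun h' ↦ h h'.symm) hwz hvw huw hvz huz⟩⟩

/-- Each red edge completes its own diamond with `uv`; the two fourth vertices differ, as one edge
lies in only one triangle. -/
lemma not_redAdj_redAdj (huv : u ≠ v) (h : ¬ G.Adj u v) (huw : G.RedAdj u w)
    (hvw : G.RedAdj v w) : False := by
  obtain ⟨huw, x, hux, hwx⟩ := huw
  obtain ⟨hvw, y, hvy, hwy⟩ := hvw
  have hxv : v ≠ x := by rintro rfl; exact h hux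
  have hyu : u ≠ y := by rintro rfl; exact h hvy.symm
  have h1 := sup_isDiamond_red huv huw hvw hux hwx hxv
  have h2 := sup_isDiamond_red huv.symm hvw huw hvy hwy hyu
  rw [edge_comm v u] at h2
  have := h1.eq_of_copyCount_eq_one (hG.2 u v huv h) h2
  have hx : x ∈ ({v, u, w, y} : Set V) := by rw [← this]; simp
  simp only [Set.mem_insert_iff, Set.mem_singleton_iff] at hx
  rcases hx with rfl | rfl | rfl | rfl
  · exact hxv rfl
  · exact hux.ne rfl
  · exact hwx.ne rfl
  · exact huv (hG.eq_of_common hwx huw.symm hux.symm hvw.symm hvy.symm)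

/-- Two non-adjacent vertices have either exactly two common neighbours, joined to them by blue
edges only, or exactly one, joined to them by one edge of each colour. -/
lemma common_cases (huv : u ≠ v) (h : ¬ G.Adj u v) :
    (∃ w z, w ≠ z ∧ (∀ y, G.Adj u y ∧ G.Adj v y ↔ y = w ∨ y = z) ∧
      G.BlueAdj u w ∧ G.BlueAdj v w ∧ G.BlueAdj u z ∧ G.BlueAdj v z) ∨
    ∃ w, (∀ y, G.Adj u y ∧ G.Adj v y ↔ y = w) ∧
      (G.RedAdj u w ∧ G.BlueAdj v w ∨ G.BlueAdj u w ∧ G.RedAdj v w) := by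
  by_cases h2 : ∃ w z, w ≠ z ∧ G.Adj u w ∧ G.Adj v w ∧ G.Adj u z ∧ G.Adj v z
  · obtain ⟨w, z, hwz, h1, h2, h3, h4⟩ := h2
    have hw := hG.blueAdj_of_two huv h hwz h1 h2 h3 h4
    have hz := hG.blueAdj_of_two huv h hwz.symm h3 h4 h1 h2
    refine .inl ⟨w, z, hwz, fun y ↦ ⟨fun hy ↦ ?_, ?_⟩, hw.1, hw.2, hz.1, hz.2⟩
    · exact hG.eq_or_eq_of_common huv h hwz h1 h2 h3 h4 hy.1 hy.2
    · rintro (rfl | rfl)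
      exacts [⟨h1, h2⟩, ⟨h3, h4⟩]
  · obtain ⟨w, hu, hv, hr⟩ := (hG.exists_common huv h).resolve_left h2
    refine .inr ⟨w, fun y ↦ ⟨fun hy ↦ ?_, ?_⟩, ?_⟩
    · by_contra hne
      exact h2 ⟨y, w, hne, hy.1, hy.2, hu, hv⟩
    · rintro rfl
      exact ⟨hu, hv⟩
    · rcases hr with hr | hr
      · exact .inl ⟨hr, hv, fun h' ↦ hG.not_redAdj_redAdj huv h hr h'⟩
      · exact .inr ⟨⟨hu, fun h' ↦ hG.not_redAdj_redAdj huv h h' hr⟩, hr⟩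

end IsUniquelySaturated
end Diamond

/-! ### Degrees and the counting identity -/

section Counting

open Finset
open scoped Classical

variable {V : Type*} {G : SimpleGraph V} [Fintype V]

/-- The vertices joined to `x` by a red edge. -/
noncomputable def redNbr (G : SimpleGraph V) (x : V) : Finset V := {y | G.RedAdj x y}

/-- The vertices joined to `x` by a blue edge. -/
noncomputable def blueNbr (G : SimpleGraph V) (x : V) : Finset V := {y | G.BlueAdj x y}

/-- The neighbours of `x` along blue edges that lie in a triangle. -/
noncomputable def blueTriNbr (G : SimpleGraph V) (x : V) : Finset V :=
  {y ∈ G.blueNbr x | ∃ z, G.RedAdj y z}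

@[simp] lemma mem_redNbr {x y : V} : y ∈ G.redNbr x ↔ G.RedAdj x y := by simp [redNbr]

@[simp] lemma mem_blueNbr {x y : V} : y ∈ G.blueNbr x ↔ G.BlueAdj x y := by simp [blueNbr]

@[simp] lemma mem_blueTriNbr {x y : V} :
    y ∈ G.blueTriNbr x ↔ G.BlueAdj x y ∧ ∃ z, G.RedAdj y z := by simp [blueTriNbr]

namespace IsUniquelySaturated

variable (hG : G.IsUniquelySaturated diamond) {x y z w : V}
include hG

lemma redAdj_of_redAdj (hy : G.RedAdj x y) (hz : G.RedAdj x z) (hne : y ≠ z) : G.RedAdj y z := by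
  have h : G.Adj y z := by
    by_contra h
    exact hG.not_redAdj_redAdj hne h hy.symm hz.symm
  exact ⟨h, x, hy.1.symm, hz.1.symm⟩

lemma exists_redNbr_eq (h : G.RedAdj x y) :
    ∃ z, y ≠ z ∧ G.RedAdj x z ∧ G.RedAdj y z ∧ G.redNbr x = {y, z} := by
  obtain ⟨z, hyz, hxz, hyz'⟩ := h.exists_triangle
  refine ⟨z, hyz, hxz, hyz', ?_⟩
  ext w
  simp only [mem_redNbr, mem_insert, mem_singleton]
  refine ⟨fun hw ↦ or_iff_not_imp_left.2 fun hwy ↦ ?_, ?_⟩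
  · exact hG.eq_of_common h.1 hw.1 (hG.redAdj_of_redAdj h hw (Ne.symm hwy)).1 hxz.1 hyz'.1
  · rintro (rfl | rfl)
    exacts [h, hxz]

lemma card_redNbr (h : G.RedAdj x y) : #(G.redNbr x) = 2 := by
  obtain ⟨z, hyz, -, -, he⟩ := hG.exists_redNbr_eq h
  rw [he, card_pair hyz]

lemma exists_other_common (huv : x ≠ y) (hx : G.BlueAdj x w) (hy : G.BlueAdj y w) :
    ∃ z, w ≠ z ∧ (∀ u, G.Adj x u ∧ G.Adj y u ↔ u = w ∨ u = z) ∧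
      G.BlueAdj x z ∧ G.BlueAdj y z := by
  have hn := hx.not_adj_of_adj hy.1.symm
  rcases hG.common_cases huv hn with ⟨a, b, hab, hc, h1, h2, h3, h4⟩ | ⟨a, hc, h⟩
  · rcases (hc w).1 ⟨hx.1, hy.1⟩ with rfl | rfl
    · exact ⟨b, hab, hc, h3, h4⟩
    · exact ⟨a, hab.symm, fun u ↦ (hc u).trans or_comm, h1, h2⟩
  · obtain rfl := (hc w).1 ⟨hx.1, hy.1⟩
    rcases h with h | h
    · exact (hx.2 h.1).elim
    · exact (hy.2 h.2).elim

/-- Each further blue neighbour of `x` completes the path through `x` to `y` to a unique blue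
4-cycle, whose fourth vertex is a blue neighbour of `y`; this matching is injective. -/
lemma card_blueNbr_le (h : G.BlueAdj x y) : #(G.blueNbr x) ≤ #(G.blueNbr y) := by
  have hy : y ∈ G.blueNbr x := by simpa
  have hx : x ∈ G.blueNbr y := by simpa using h.symm
  rw [← card_erase_add_one hy, ← card_erase_add_one hx, Nat.add_le_add_iff_right]
  refine card_le_card_of_forall_subsingleton G.Adj (fun a ha ↦ ?_) fun b hb a ha a' ha' ↦ ?_
  · simp only [mem_erase, mem_blueNbr] at ha
    obtain ⟨z, hz, -, h1, h2⟩ := hG.exists_other_common ha.1 ha.2.symm h.symm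
    exact ⟨z, by simp [hz.symm, h2], h1.1⟩
  · simp only [mem_erase, mem_blueNbr, Set.mem_ofPred_eq] at hb ha ha'
    obtain ⟨z, -, hc, -⟩ := hG.exists_other_common hb.1.symm h hb.2.symm
    have h1 := ((hc a).1 ⟨ha.1.2.1, ha.2.symm⟩).resolve_left ha.1.1
    have h2 := ((hc a').1 ⟨ha'.1.2.1, ha'.2.symm⟩).resolve_left ha'.1.1
    rw [h1, h2]

lemma card_blueNbr_eq (h : G.BlueAdj x y) : #(G.blueNbr x) = #(G.blueNbr y) :=
  (hG.card_blueNbr_le h).antisymm (hG.card_blueNbr_le h.symm)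

/-- The weights make every non-adjacent pair count 2. Adjacent pairs count 0, since a blue edge lies
in no triangle, and closed walks give the diagonal term. -/
lemma sum_paths (x y : V) :
    (∑ w, (2 * ((if G.BlueAdj x w then 1 else 0) * if G.RedAdj w y then 1 else 0) +
      2 * ((if G.RedAdj x w then 1 else 0) * if G.BlueAdj w y then 1 else 0) +
      (if G.BlueAdj x w then 1 else 0) * if G.BlueAdj w y then 1 else 0) : ℤ) =
    2 + (if y = x then (#(G.blueNbr x) : ℤ) - 2 else 0) - 2 * (if G.BlueAdj x y then 1 else 0) -
      2 * if G.RedAdj x y then 1 else 0 := by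
  by_cases hxy : y = x
  · subst hxy
    have h1 : ¬ G.BlueAdj y y := fun h ↦ h.1.ne rfl
    have h2 : ¬ G.RedAdj y y := fun h ↦ h.1.ne rfl
    have h3 : ∀ w, (2 * ((if G.BlueAdj y w then 1 else 0) * if G.RedAdj w y then 1 else 0) +
        2 * ((if G.RedAdj y w then 1 else 0) * if G.BlueAdj w y then 1 else 0) +
        (if G.BlueAdj y w then 1 else 0) * if G.BlueAdj w y then 1 else 0 : ℤ) =
        if G.BlueAdj y w then 1 else 0 := by
      intro w
      rw [redAdj_comm (x := w), blueAdj_comm (x := w)]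
      by_cases h : G.BlueAdj y w
      · simp [h, h.2]
      · simp [h]
    rw [Fintype.sum_congr _ _ h3]
    simp [h1, h2, blueNbr]
  by_cases hadj : G.Adj x y
  · have h3 : ∀ w, (2 * ((if G.BlueAdj x w then 1 else 0) * if G.RedAdj w y then 1 else 0) +
        2 * ((if G.RedAdj x w then 1 else 0) * if G.BlueAdj w y then 1 else 0) +
        (if G.BlueAdj x w then 1 else 0) * if G.BlueAdj w y then 1 else 0 : ℤ) = 0 := by
      intro w
      by_cases h : G.Adj x w ∧ G.Adj w y
      · have h4 : ¬ G.BlueAdj x w := fun h' ↦ h'.not_adj_of_adj h.2 hadj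
        have h5 : ¬ G.BlueAdj w y := fun h' ↦ h'.symm.not_adj_of_adj h.1.symm hadj.symm
        simp [h4, h5]
      · by_cases h6 : G.Adj x w
        · have h7 : ¬ G.Adj w y := fun h' ↦ h ⟨h6, h'⟩
          simp [BlueAdj, RedAdj, h7]
        · simp [BlueAdj, RedAdj, h6]
    have h8 : (2 * (if G.BlueAdj x y then 1 else 0) + 2 * if G.RedAdj x y then 1 else 0 : ℤ) = 2 := by
      by_cases h : G.RedAdj x y <;> simp [BlueAdj, h, hadj]
    simp only [h3, hxy, sum_const_zero, if_false]
    linarith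
  · have h1 : ¬ G.BlueAdj x y := fun h ↦ hadj h.1
    have h2 : ¬ G.RedAdj x y := fun h ↦ hadj h.1
    simp only [hxy, h1, h2, if_false]
    rcases hG.common_cases (Ne.symm hxy) hadj with ⟨a, b, hab, hc, h3, h4, h5, h6⟩ | ⟨a, hc, h⟩
    · rw [← sum_subset (subset_univ {a, b}), sum_pair hab]
      · simp [h3, h4.symm, h5, h6.symm, h3.2, h5.2, h4.symm.2, h6.symm.2]
      · intro w _ hw
        simp only [mem_insert, mem_singleton] at hw
        rw [← hc, not_and_or] at hw
        rcases hw with hw | hw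
        · simp [BlueAdj, RedAdj, hw]
        · simp [BlueAdj, RedAdj, G.adj_comm w y, hw]
    · rw [← sum_subset (subset_univ {a}), sum_singleton]
      · rcases h with ⟨h3, h4⟩ | ⟨h3, h4⟩
        · have : ¬ G.BlueAdj x a := fun h' ↦ h'.2 h3
          simp [h3, h4.symm, this]
        · have : ¬ G.BlueAdj a y := fun h' ↦ h'.2 h4.symm
          simp [h3, h4.symm, this]
      · intro w _ hw
        simp only [mem_singleton] at hw
        rw [← hc, not_and_or] at hw
        rcases hw with hw | hw
        · simp [BlueAdj, RedAdj, hw]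
        · simp [BlueAdj, RedAdj, G.adj_comm w y, hw]

/-- Sum `sum_paths` over `y`, using that red degrees are 0 or 2 and that blue neighbours share their
blue degree. -/
lemma card_eq (x : V) :
    2 * Fintype.card V = 2 + 2 * #(G.redNbr x) + 4 * #(G.blueTriNbr x) +
      2 * ∑ w ∈ G.redNbr x, #(G.blueNbr w) + #(G.blueNbr x) ^ 2 + #(G.blueNbr x) := by
  have h := Fintype.sum_congr _ _ (hG.sum_paths x)
  rw [sum_comm] at h
  simp only [sum_add_distrib, sum_sub_distrib, ← mul_sum] at h
  have hr : ∀ w, (∑ y, if G.RedAdj w y then 1 else 0 : ℤ) = #(G.redNbr w) := by simp [redNbr]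
  have hb : ∀ w, (∑ y, if G.BlueAdj w y then 1 else 0 : ℤ) = #(G.blueNbr w) := by simp [blueNbr]
  simp only [hr, hb, ite_mul, one_mul, zero_mul, ← sum_filter] at h
  have e1 : ∑ w with G.BlueAdj x w, (#(G.redNbr w) : ℤ) = 2 * #(G.blueTriNbr x) := by
    have : ∀ w, (#(G.redNbr w) : ℤ) = if ∃ z, G.RedAdj w z then 2 else 0 := by
      intro w
      split_ifs with hw
      · obtain ⟨z, hz⟩ := hw
        rw [hG.card_redNbr hz]; rfl
      · rw [Nat.cast_eq_zero, card_eq_zero, eq_empty_iff_forall_notMem]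
        exact fun z hz ↦ hw ⟨z, by simpa using hz⟩
    rw [sum_congr rfl fun w _ ↦ this w, ← sum_filter, sum_const, nsmul_eq_mul, mul_comm]
    rfl
  have e2 : ∑ w with G.BlueAdj x w, (#(G.blueNbr w) : ℤ) = (#(G.blueNbr x) : ℤ) ^ 2 := by
    rw [sum_congr rfl (g := fun _ ↦ (#(G.blueNbr x) : ℤ)), sum_const, nsmul_eq_mul, sq]
    · rfl
    · intro w hw
      rw [hG.card_blueNbr_eq (mem_filter.1 hw).2]
  have e3 : ∑ w with G.RedAdj x w, (#(G.blueNbr w) : ℤ) = ∑ w ∈ G.redNbr x, (#(G.blueNbr w) : ℤ) :=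
    rfl
  rw [e1, e2, e3] at h
  have e4 : #{a | a = x} = 1 := card_eq_one.2 ⟨x, by ext; simp⟩
  simp only [sum_const, card_univ, nsmul_eq_mul, e4, Nat.cast_one, one_mul] at h
  zify
  linarith

end IsUniquelySaturated
end Counting

/-! ### Triangles seen from inside and outside -/

section Triangles

open Finset
open scoped Classical

variable {V : Type*} {G : SimpleGraph V}

lemma redAdj_of_isNClique {s : Finset V} (hs : G.IsNClique 3 s) {x y : V} (hx : x ∈ s)
    (hy : y ∈ s) (hxy : x ≠ y) : G.RedAdj x y := by
  obtain ⟨z, hz, hzn⟩ := exists_mem_notMem_of_card_lt_card (s := {x, y}) (t := s)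
    (by rw [card_pair hxy, hs.card_eq]; norm_num)
  simp only [mem_insert, mem_singleton, not_or] at hzn
  exact ⟨hs.isClique hx hy hxy, z, hs.isClique hx hz (Ne.symm hzn.1),
    hs.isClique hy hz (Ne.symm hzn.2)⟩

lemma eq_of_blueAdj_of_isNClique {s : Finset V} (hs : G.IsNClique 3 s) {v x y : V} (hx : x ∈ s)
    (hy : y ∈ s) (hvx : G.BlueAdj v x) (hvy : G.BlueAdj v y) : x = y := by
  by_contra hne
  exact hvx.not_adj_of_adj (hs.isClique hx hy hne) hvy.1

lemma exists_redAdj_of_isNClique {s : Finset V} (hs : G.IsNClique 3 s) {x : V} (hx : x ∈ s) :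
    ∃ y, G.RedAdj x y := by
  obtain ⟨y, hy, hyx⟩ := exists_mem_ne (by rw [hs.card_eq]; norm_num) x
  exact ⟨y, redAdj_of_isNClique hs hx hy hyx.symm⟩

variable [Fintype V]

lemma card_blueTriNbr_le (x : V) : #(G.blueTriNbr x) ≤ #(G.blueNbr x) :=
  card_le_card (filter_subset _ _)

lemma redNbr_eq_empty {x : V} (h : ¬ ∃ y, G.RedAdj x y) : G.redNbr x = ∅ :=
  eq_empty_iff_forall_notMem.2 fun y hy ↦ h ⟨y, by simpa using hy⟩

lemma card_cliqueFinset_three : #(G.cliqueFinset 3) = G.triangleCount := by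
  rw [triangleCount, ← coe_cliqueFinset, Set.ncard_coe_finset]

namespace IsUniquelySaturated

variable (hG : G.IsUniquelySaturated diamond) {x y z v : V} {s t : Finset V}
include hG

lemma isNClique_insert_redNbr (h : G.RedAdj x y) : G.IsNClique 3 (insert x (G.redNbr x)) := by
  obtain ⟨z, -, hxz, hyz, he⟩ := hG.exists_redNbr_eq h
  rw [he, is3Clique_triple_iff]
  exact ⟨h.1, hxz.1, hyz.1⟩

lemma eq_insert_redNbr (hs : G.IsNClique 3 s) (hx : x ∈ s) : s = insert x (G.redNbr x) := by
  obtain ⟨y, hy⟩ := exists_redAdj_of_isNClique hs hx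
  refine eq_of_subset_of_card_le (fun w hw ↦ ?_) ?_
  · by_cases hwx : w = x
    · simp [hwx]
    · simp [redAdj_of_isNClique hs hx hw (Ne.symm hwx)]
  · rw [(hG.isNClique_insert_redNbr hy).card_eq, hs.card_eq]

lemma card_eq_of_redAdj (h : G.RedAdj x y) (h' : G.RedAdj x z) (hyz : y ≠ z) :
    2 * Fintype.card V = 6 + 4 * #(G.blueTriNbr x) +
      2 * (#(G.blueNbr y) + #(G.blueNbr z)) + #(G.blueNbr x) ^ 2 + #(G.blueNbr x) := by
  obtain ⟨w, hyw, -, -, he⟩ := hG.exists_redNbr_eq h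
  have hz : z ∈ G.redNbr x := by simpa
  rw [he] at hz
  obtain rfl : z = w := by simpa [hyz.symm] using hz
  rw [hG.card_eq x, he, card_pair hyz, sum_pair hyz]

lemma card_eq_of_forall_not_redAdj (h : ¬ ∃ y, G.RedAdj x y) :
    2 * Fintype.card V = 2 + 4 * #(G.blueTriNbr x) + #(G.blueNbr x) ^ 2 + #(G.blueNbr x) := by
  rw [hG.card_eq x, redNbr_eq_empty h]
  simp

lemma exists_not_redAdj (h4 : G.triangleCount = 4) : ∃ v, ¬ ∃ y, G.RedAdj v y := by
  by_contra! hall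
  have hs : ∀ x, G.blueTriNbr x = G.blueNbr x := fun x ↦ by ext; simp [hall]
  -- The four triangles would partition the vertices.
  have hn : Fintype.card V = 12 := by
    have h1 : ∀ a, #{s ∈ G.cliqueFinset 3 | a ∈ s} = 1 := by
      intro a
      obtain ⟨y, hy⟩ := hall a
      rw [card_eq_one]
      refine ⟨insert a (G.redNbr a), ?_⟩
      ext s
      simp only [mem_filter, mem_cliqueFinset_iff, mem_singleton]
      refine ⟨fun h ↦ hG.eq_insert_redNbr h.1 h.2, ?_⟩
      rintro rfl
      exact ⟨hG.isNClique_insert_redNbr hy, mem_insert_self _ _⟩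
    have h2 := sum_card h1
    rw [sum_congr rfl (g := fun _ ↦ 3) fun s hs ↦ ((mem_cliqueFinset_iff).1 hs).card_eq,
      sum_const, card_cliqueFinset_three, h4] at h2
    simpa using h2.symm
  have : Nonempty V := Fintype.card_pos_iff.1 (by omega)
  obtain ⟨y, hxy⟩ := hall (Classical.arbitrary V)
  obtain ⟨z, hyz, hxz, hyz'⟩ := hxy.exists_triangle
  have e1 := hG.card_eq_of_redAdj hxy hxz hyz
  have e2 := hG.card_eq_of_redAdj hxy.symm hyz' hxz.1.ne
  have e3 := hG.card_eq_of_redAdj hxz.symm hyz'.symm hxy.1.ne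
  rw [hn, hs] at e1 e2 e3
  generalize #(G.blueNbr (Classical.arbitrary V)) = a at *
  generalize #(G.blueNbr y) = b at *
  generalize #(G.blueNbr z) = c at *
  have ha : a ≤ 3 := by nlinarith
  have hb : b ≤ 3 := by nlinarith
  have hc : c ≤ 3 := by nlinarith
  interval_cases a <;> interval_cases b <;> interval_cases c <;> omega

lemma card_blueTriNbr_le_of_redAdj (h : G.RedAdj x y) :
    #(G.blueTriNbr x) + 1 ≤ G.triangleCount := by
  have hT : insert x (G.redNbr x) ∈ G.cliqueFinset 3 :=
    mem_cliqueFinset_iff.2 (hG.isNClique_insert_redNbr h)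
  rw [← card_cliqueFinset_three, ← card_erase_add_one hT, Nat.add_le_add_iff_right]
  refine card_le_card_of_forall_subsingleton (· ∈ ·) (fun w hw ↦ ?_) fun s hs a ha b hb ↦ ?_
  · obtain ⟨hw, u, hu⟩ := mem_blueTriNbr.1 hw
    refine ⟨insert w (G.redNbr w), mem_erase.2 ⟨fun he ↦ ?_, ?_⟩, mem_insert_self _ _⟩
    · have hx : x ∈ insert w (G.redNbr w) := he ▸ mem_insert_self _ _
      rcases mem_insert.1 hx with rfl | hx
      · exact hw.1.ne rfl
      · exact hw.symm.2 (mem_redNbr.1 hx)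
    · exact mem_cliqueFinset_iff.2 (hG.isNClique_insert_redNbr hu)
  · exact eq_of_blueAdj_of_isNClique (mem_cliqueFinset_iff.1 (mem_erase.1 hs).2) ha.2 hb.2
      (mem_blueTriNbr.1 ha.1).1 (mem_blueTriNbr.1 hb.1).1

/-- Otherwise two blue paths join `v` to each vertex of `s`, so all blue degrees agree and `card_eq`
at `s` exceeds `card_eq` at `v`. -/
lemma exists_blueAdj_mem (hv : ¬ ∃ y, G.RedAdj v y) (hs : G.IsNClique 3 s) :
    ∃ x ∈ s, G.BlueAdj v x := by
  by_contra! hall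
  have hd : ∀ x ∈ s, #(G.blueNbr x) = #(G.blueNbr v) := by
    intro x hx
    have hvx : v ≠ x := by
      rintro rfl
      exact hv (exists_redAdj_of_isNClique hs hx)
    have hadj : ¬ G.Adj v x := fun h ↦ hall x hx ⟨h, fun h ↦ hv ⟨x, h⟩⟩
    rcases hG.common_cases hvx hadj with ⟨a, b, -, -, h1, h2, -⟩ | ⟨a, -, h | h⟩
    · rw [hG.card_blueNbr_eq h1, hG.card_blueNbr_eq h2]
    · exact (hv ⟨a, h.1⟩).elim
    · refine (hall a ?_ h.1).elim
      rw [hG.eq_insert_redNbr hs hx]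
      simp [h.2]
  obtain ⟨p, q, r, hpq, hpr, hqr, rfl⟩ := is3Clique_iff.1 hs
  have e := hG.card_eq_of_redAdj
    (redAdj_of_isNClique hs (x := p) (y := q) (by simp) (by simp) hpq.ne)
    (redAdj_of_isNClique hs (x := p) (y := r) (by simp) (by simp) hpr.ne) hqr.ne
  rw [hd p (by simp), hd q (by simp), hd r (by simp)] at e
  have e' := hG.card_eq_of_forall_not_redAdj hv
  have := card_blueTriNbr_le (G := G) v
  omega

lemma card_blueTriNbr_of_forall_not_redAdj (hv : ¬ ∃ y, G.RedAdj v y) :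
    #(G.blueTriNbr v) = G.triangleCount := by
  rw [← card_cliqueFinset_three]
  apply le_antisymm
  · refine card_le_card_of_forall_subsingleton (· ∈ ·) (fun w hw ↦ ?_) fun s hs a ha b hb ↦ ?_
    · obtain ⟨hw, u, hu⟩ := mem_blueTriNbr.1 hw
      exact ⟨_, mem_cliqueFinset_iff.2 (hG.isNClique_insert_redNbr hu), mem_insert_self _ _⟩
    · exact eq_of_blueAdj_of_isNClique (mem_cliqueFinset_iff.1 hs) ha.2 hb.2
        (mem_blueTriNbr.1 ha.1).1 (mem_blueTriNbr.1 hb.1).1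
  · refine card_le_card_of_forall_subsingleton (fun s x ↦ x ∈ s) (fun s hs ↦ ?_)
      fun w hw s hs t ht ↦ ?_
    · rw [mem_cliqueFinset_iff] at hs
      obtain ⟨x, hx, hvx⟩ := hG.exists_blueAdj_mem hv hs
      exact ⟨x, mem_blueTriNbr.2 ⟨hvx, exists_redAdj_of_isNClique hs hx⟩, hx⟩
    · rw [hG.eq_insert_redNbr (mem_cliqueFinset_iff.1 hs.1) hs.2,
        hG.eq_insert_redNbr (mem_cliqueFinset_iff.1 ht.1) ht.2]

/-- A vertex in a triangle has the blue degree of the vertices outside all triangles, or all its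
blue neighbours lie in triangles. -/
lemma card_blueNbr_eq_or (hv : ¬ ∃ y, G.RedAdj v y) (x : V) :
    #(G.blueNbr x) = #(G.blueNbr v) ∨ #(G.blueTriNbr x) = #(G.blueNbr x) := by
  by_cases h : ∃ w, G.BlueAdj x w ∧ ¬ ∃ y, G.RedAdj w y
  · obtain ⟨w, hxw, hw⟩ := h
    -- Both `w` and `v` see every triangle, so `card_eq` determines the same blue degree for them.
    left
    rw [hG.card_blueNbr_eq hxw]
    have e1 := hG.card_eq_of_forall_not_redAdj hw
    have e2 := hG.card_eq_of_forall_not_redAdj hv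
    rw [hG.card_blueTriNbr_of_forall_not_redAdj hw] at e1
    rw [hG.card_blueTriNbr_of_forall_not_redAdj hv] at e2
    nlinarith
  · right
    congr 1
    ext w
    simp only [mem_blueTriNbr, mem_blueNbr, and_iff_left_iff_imp]
    exact fun hw ↦ by_contra fun hn ↦ h ⟨w, hw, hn⟩

end IsUniquelySaturated
end Triangles
end SimpleGraph

/-! ### The final case check -/

open SimpleGraph in
theorem mainTheorem6 {V : Type*} [Fintype V] (G : SimpleGraph V)
    (hG : G.IsUniquelySaturated SimpleGraph.diamond) :
    G.triangleCount ≠ 4 := by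
  classical
  intro h4
  obtain ⟨v, hv⟩ := hG.exists_not_redAdj h4
  have hsv := hG.card_blueTriNbr_of_forall_not_redAdj hv
  have ev := hG.card_eq_of_forall_not_redAdj hv
  have hle := card_blueTriNbr_le (G := G) v
  rw [hsv, h4] at ev hle
  obtain ⟨s, hs⟩ : (G.cliqueFinset 3).Nonempty := by
    rw [← Finset.card_pos, card_cliqueFinset_three, h4]
    norm_num
  obtain ⟨p, hp, hvp⟩ := hG.exists_blueAdj_mem hv (mem_cliqueFinset_iff.1 hs)
  obtain ⟨q, hpq⟩ := exists_redAdj_of_isNClique (mem_cliqueFinset_iff.1 hs) hp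
  obtain ⟨r, hqr, hpr, hqr'⟩ := hpq.exists_triangle
  have ep := hG.card_eq_of_redAdj hpq hpr hqr
  have eq := hG.card_eq_of_redAdj hpq.symm hqr' hpr.1.ne
  have er := hG.card_eq_of_redAdj hpr.symm hqr'.symm hpq.1.ne
  have hq := hG.card_blueNbr_eq_or hv q
  have hr := hG.card_blueNbr_eq_or hv r
  have hq3 := hG.card_blueTriNbr_le_of_redAdj hpq.symm
  have hr3 := hG.card_blueTriNbr_le_of_redAdj hpr.symm
  rw [← hG.card_blueNbr_eq hvp] at ep eq er
  rw [h4] at hq3 hr3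
  generalize (G.blueNbr v).card = k at *
  generalize (G.blueNbr q).card = a at *
  generalize (G.blueNbr r).card = b at *
  -- Comparing `ev` with `ep` gives `a + b + 2t = 6`, where `t` is the size of `blueTriNbr p`. So `k
  -- ≤ 6` if `a` or `b` equals `k`; otherwise `a, b ≤ 3`, and `ev` against `eq` bounds `k`.
  have hk : k ≤ 6 := by
    rcases hq with hq | hq <;> rcases hr with hr | hr
    · omega
    · omega
    · omega
    · have ha : a ≤ 3 := by omega
      have hb : b ≤ 3 := by omega
      rw [hq] at eq
      clear ep er hq3 hr3 hle hq hr
      by_contra! hk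
      interval_cases a <;> nlinarith
  have ha : a ≤ 6 := by omega
  have hb : b ≤ 6 := by omega
  interval_cases k <;> interval_cases a <;> interval_cases b <;> omega
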